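/- Let $p$ be a prime, let $F$ be a perfect field of characteristic $p$, and let $L$ be an abelian restricted Lie algebra over $F$ (of arbitrary dimension) with power mapping $x\mapsto x^{[p]}$. Let $u(L)$ be the restricted enveloping algebra of $L$, that is, the quotient of the universal enveloping algebra $U(L)$ by the two-sided ideal generated by all elements $x^p-x^{[p]}$ with $x\in L$. A restricted ideal of $L$ is a Lie ideal closed under the power mapping; it is $p$-nil if each of its elements $x$ satisfies $x^{[p]^n}=0$ for some $n\ge 0$ (depending on $x$), where $x^{[p]^n}$ is obtained by applying the power mapping $n$ times. Let $\mathcal{O}_p(L)$ be the sum of all $p$-nil restricted ideals of $L$. A ring $R$ with unity and Jacobson radical $\mathcal{J}(R)$ is called semiperfect if $R/\mathcal{J}(R)$ is Artinian and every idempotent of $R/\mathcal{J}(R)$ lifts to an idempotent of $R$. Then $u(L)$ is semiperfect if and only if $\dim_F L/\mathcal{O}_p(L)<\infty$. -/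

import Mathlib

/-- `RestrictedLie.adCoeff x y k j` is the coefficient of `t ^ j` in `(ad (t x + y)) ^ k (x)`,
computed in `L ⊗ F[t]`: applying `ad (t x + y)` sends `∑ c_j t ^ j` to
`∑ (⁅y, c_j⁆ + ⁅x, c_{j-1}⁆) t ^ j`. -/
def RestrictedLie.adCoeff {L : Type*} [LieRing L] (x y : L) : ℕ → ℕ → L
  | 0, 0 => x
  | 0, _ + 1 => 0
  | k + 1, 0 => ⁅y, RestrictedLie.adCoeff x y k 0⁆
  | k + 1, j + 1 => ⁅y, RestrictedLie.adCoeff x y k (j + 1)⁆ + ⁅x, RestrictedLie.adCoeff x y k j⁆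

/-- Jacobson's Lie polynomial `s_i(x, y)`: for `1 ≤ i ≤ p - 1`, the element `i • s_i(x, y)` is the
coefficient of `t ^ (i - 1)` in `(ad (t x + y)) ^ (p - 1) (x)`. -/
noncomputable def RestrictedLie.jacobsonS (F : Type*) {L : Type*} [Field F] [LieRing L]
    [LieAlgebra F L] (p i : ℕ) (x y : L) : L :=
  (i : F)⁻¹ • RestrictedLie.adCoeff x y (p - 1) (i - 1)

/-- A restricted Lie algebra structure on a Lie algebra `L` over a field `F` of prime
characteristic `p`: a power mapping `x ↦ x^[p]` subject to Jacobson's three axioms. -/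
class RestrictedLieAlgebra (F : Type*) (p : ℕ) (L : Type*) [Field F] [LieRing L]
    [LieAlgebra F L] where
  /-- The power mapping `x ↦ x^[p]`. -/
  pMap : L → L
  ad_pMap : ∀ x : L, LieAlgebra.ad F L (pMap x) = LieAlgebra.ad F L x ^ p
  pMap_smul : ∀ (a : F) (x : L), pMap (a • x) = a ^ p • pMap x
  pMap_add : ∀ x y : L, pMap (x + y) =
    pMap x + pMap y + ∑ i ∈ Finset.Icc 1 (p - 1), RestrictedLie.jacobsonS F p i x y

/-- The relations `x ^ p = x^[p]`, for `x` in `L`, on the universal enveloping algebra of `L`. -/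
inductive RestrictedLie.Rel (F : Type*) (p : ℕ) (L : Type*) [Field F] [LieRing L]
    [LieAlgebra F L] [RestrictedLieAlgebra F p L] :
    UniversalEnvelopingAlgebra F L → UniversalEnvelopingAlgebra F L → Prop
  | pow (x : L) : RestrictedLie.Rel F p L (UniversalEnvelopingAlgebra.ι F x ^ p)
      (UniversalEnvelopingAlgebra.ι F (RestrictedLieAlgebra.pMap F p x))

/-- The restricted enveloping algebra `u(L)`: the quotient of the universal enveloping algebra
of `L` by the two-sided ideal generated by all `x ^ p - x^[p]` with `x` in `L`. -/
abbrev RestrictedEnvelopingAlgebra (F : Type*) (p : ℕ) (L : Type*) [Field F] [LieRing L]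
    [LieAlgebra F L] [RestrictedLieAlgebra F p L] : Type _ :=
  RingQuot (RestrictedLie.Rel F p L)

/-- A ring `R` with Jacobson radical `J` is semiperfect if `R / J` is Artinian and every
idempotent of `R / J` lifts to an idempotent of `R`. -/
structure IsSemiperfectRing (R : Type*) [Ring R] : Prop where
  isArtinianRing_quotient : IsArtinianRing (R ⧸ Ring.jacobson R)
  exists_idempotent_lift : ∀ e : R ⧸ Ring.jacobson R, IsIdempotentElem e →
    ∃ f : R, IsIdempotentElem f ∧ Ideal.Quotient.mk (Ring.jacobson R) f = e

/-- An element `x` is `p`-nilpotent if some iterate of the power mapping sends it to `0`. -/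
def RestrictedLie.IsPNilpotent (F : Type*) (p : ℕ) {L : Type*} [Field F] [LieRing L]
    [LieAlgebra F L] [RestrictedLieAlgebra F p L] (x : L) : Prop :=
  ∃ n : ℕ, (RestrictedLieAlgebra.pMap F p)^[n] x = 0

/-- A restricted ideal: a Lie ideal closed under the power mapping. -/
def RestrictedLie.IsRestrictedIdeal {F : Type*} (p : ℕ) {L : Type*} [Field F] [LieRing L]
    [LieAlgebra F L] [RestrictedLieAlgebra F p L] (I : LieIdeal F L) : Prop :=
  ∀ x ∈ I, RestrictedLieAlgebra.pMap F p x ∈ I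

/-- `O_p(L)`: the sum of all `p`-nil restricted ideals of `L`. -/
def RestrictedLie.pCore (F : Type*) (p : ℕ) (L : Type*) [Field F] [LieRing L]
    [LieAlgebra F L] [RestrictedLieAlgebra F p L] : LieIdeal F L :=
  sSup {I : LieIdeal F L | RestrictedLie.IsRestrictedIdeal p I ∧
    ∀ x ∈ I, RestrictedLie.IsPNilpotent F p x}

/-! For abelian `L` the power mapping `φ` is Frobenius-semilinear, `u(L)` is commutative, and the
p-nilpotent elements form `N = O_p(L)`. Let `K` be an algebraic closure of `F`. A linear `f : L → K`
with `f (φ x) = f x ^ p` extends to an algebra map `u(L) → K`, whose kernel is a maximal ideal that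
determines `ker f`.

If `u(L)` is semiperfect it has finitely many maximal ideals, so only finitely many kernels `ker f`
occur. Such `f` are plentiful (`IsStableGraph.exists_linearMap`): an `x` satisfying no twisted
polynomial relation could take every value in the infinite field `K`, and an `x` whose orbit avoids
a stable `U` is separated from `U`. Hence finitely many finite-dimensional orbit spans make up a
stable `U` absorbing every orbit, and Fitting's lemma, where perfectness enters, gives `L = U + N`.

Conversely, `N` becomes zero in `u(L)` modulo its nilradical. If `L/N` is finite-dimensional, that
quotient is generated by finitely many algebraic elements, hence is Artinian, and idempotents lift
modulo a nil ideal. -/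

namespace FrobeniusSemilinear

open Polynomial

/-! ### Orbits as modules over twisted polynomials; Fitting's lemma -/

section Orbit

variable {F : Type*} [Field F] {p : ℕ} [ExpChar F p]
variable {W : Type*} [AddCommGroup W] [Module F W] (φ : W →ₛₗ[frobenius F p] W)

/-- The linear map `F[X] → W` sending `X ^ i` to `φ^[i] x`. -/
noncomputable def orbitMap (x : W) : F[X] →ₗ[F] W :=
  Polynomial.lsum fun i => LinearMap.toSpanSingleton F W (φ^[i] x)

theorem orbitMap_monomial (x : W) (i : ℕ) (a : F) :
    orbitMap φ x (monomial i a) = a • φ^[i] x := by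
  simp [orbitMap, Polynomial.lsum_apply]

variable (F p) in
/-- Left multiplication by the variable in the twisted polynomial ring. -/
noncomputable def twist : F[X] →+ F[X] where
  toFun q := q.map (frobenius F p) * X
  map_zero' := by simp
  map_add' := by simp [add_mul]

theorem twist_monomial (i : ℕ) (a : F) :
    twist F p (monomial i a) = monomial (i + 1) (a ^ p) := by
  simp [twist, Polynomial.monomial_mul_X, frobenius_def]

theorem twist_ne_zero {q : F[X]} (hq : q ≠ 0) : twist F p q ≠ 0 := by
  have := (Polynomial.map_ne_zero_iff (frobenius F p).injective).2 hq
  simpa [twist] using this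

theorem natDegree_twist {q : F[X]} (hq : q ≠ 0) :
    (twist F p q).natDegree = q.natDegree + 1 := by
  have := (Polynomial.map_ne_zero_iff (frobenius F p).injective).2 hq
  simp [twist, Polynomial.natDegree_mul_X this,
    Polynomial.natDegree_map_eq_of_injective (frobenius F p).injective]

theorem orbitMap_twist (x : W) (q : F[X]) :
    orbitMap φ x (twist F p q) = φ (orbitMap φ x q) := by
  induction q using Polynomial.induction_on' with
  | add q r hq hr => simp [hq, hr]
  | monomial i a =>
    rw [twist_monomial, orbitMap_monomial, orbitMap_monomial, map_smulₛₗ,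
      Function.iterate_succ_apply', frobenius_def]

theorem orbitMap_X_pow (x : W) (i : ℕ) : orbitMap φ x (X ^ i) = φ^[i] x := by
  rw [← monomial_one_right_eq_X_pow, orbitMap_monomial, one_smul]

theorem orbitMap_one (x : W) : orbitMap φ x 1 = x := by
  simpa using orbitMap_X_pow φ x 0

theorem orbitMap_comp {W' : Type*} [AddCommGroup W'] [Module F W']
    {φ' : W' →ₛₗ[frobenius F p] W'} (g : W →ₗ[F] W') (hg : ∀ x, g (φ x) = φ' (g x))
    (x : W) (q : F[X]) : g (orbitMap φ x q) = orbitMap φ' (g x) q := by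
  have h : ∀ i, g (φ^[i] x) = φ'^[i] (g x) := fun i =>
    (Function.Semiconj.iterate_right (f := g) hg i) x
  induction q using Polynomial.induction_on' with
  | add q r hq hr => simp [hq, hr]
  | monomial i a => simp [orbitMap_monomial, h]

theorem map_mem_range_orbitMap {x y : W} (hy : y ∈ LinearMap.range (orbitMap φ x)) :
    φ y ∈ LinearMap.range (orbitMap φ x) := by
  obtain ⟨q, rfl⟩ := hy
  exact ⟨_, orbitMap_twist φ x q⟩

/-- Division with remainder in the twisted polynomial ring. -/
theorem exists_degree_lt_sub_mem (S : Submodule F F[X]) {q₀ : F[X]} (hq₀ : q₀ ≠ 0)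
    (hS : ∀ j, (twist F p)^[j] q₀ ∈ S) (q : F[X]) :
    ∃ r : F[X], r.degree < q₀.degree ∧ q - r ∈ S := by
  have key : ∀ j, (twist F p)^[j] q₀ ≠ 0 ∧
      ((twist F p)^[j] q₀).natDegree = q₀.natDegree + j := fun j => by
    induction j with
    | zero => exact ⟨hq₀, rfl⟩
    | succ j ih =>
      rw [Function.iterate_succ_apply']
      exact ⟨twist_ne_zero ih.1, by rw [natDegree_twist ih.1, ih.2, add_assoc]⟩
  induction hn : q.degree using WellFoundedLT.induction generalizing q with
  | ind n ih =>
    subst hn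
    by_cases hlt : q.degree < q₀.degree
    · exact ⟨q, hlt, by simp⟩
    have hle := not_lt.1 hlt
    have hq : q ≠ 0 := by
      rintro rfl
      exact hq₀ (by simpa using hle)
    have hle' : q₀.natDegree ≤ q.natDegree := natDegree_le_natDegree hle
    -- Enough twists bring `q₀` up to the degree of `q`; a scalar multiple then cancels the leading
    -- term.
    obtain ⟨h1, h2⟩ := key (q.natDegree - q₀.natDegree)
    rw [Nat.add_sub_cancel' hle'] at h2
    set s := (twist F p)^[q.natDegree - q₀.natDegree] q₀ with hs
    have hsl : s.leadingCoeff ≠ 0 := leadingCoeff_ne_zero.2 h1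
    have hc : q.leadingCoeff / s.leadingCoeff ≠ 0 :=
      div_ne_zero (leadingCoeff_ne_zero.2 hq) hsl
    have hdeg : (q - (q.leadingCoeff / s.leadingCoeff) • s).degree < q.degree := by
      refine degree_sub_lt_left ?_ hq ?_
      · rw [degree_smul_of_smul_regular _ (IsSMulRegular.of_ne_zero hc), degree_eq_natDegree hq, degree_eq_natDegree h1, h2]
      · rw [smul_eq_C_mul, leadingCoeff_mul, leadingCoeff_C, div_mul_cancel₀ _ hsl]
    obtain ⟨r, hr, hrS⟩ := ih _ hdeg _ rfl
    refine ⟨r, hr, ?_⟩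
    have := S.add_mem hrS (S.smul_mem (q.leadingCoeff / s.leadingCoeff) (hS (q.natDegree - q₀.natDegree)))
    rw [← hs] at this
    convert this using 1
    abel

/-- The annihilator of `x` is stable under `twist`, so division by `q` leaves only remainders of
degree below that of `q`. -/
theorem finiteDimensional_range_orbitMap {x : W} {q : F[X]} (hq : q ≠ 0)
    (h : orbitMap φ x q = 0) : FiniteDimensional F (LinearMap.range (orbitMap φ x)) := by
  have hS : ∀ j, (twist F p)^[j] q ∈ LinearMap.ker (orbitMap φ x) := fun j => by
    induction j with
    | zero => exact h
    | succ j ih =>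
      rw [Function.iterate_succ_apply', LinearMap.mem_ker, orbitMap_twist, LinearMap.mem_ker.1 ih,
        map_zero]
  have hle : LinearMap.range (orbitMap φ x) ≤ (degreeLT F q.natDegree).map (orbitMap φ x) := by
    rintro _ ⟨s, rfl⟩
    obtain ⟨r, hr, hrS⟩ := exists_degree_lt_sub_mem _ hq hS s
    refine ⟨r, mem_degreeLT.2 (by rwa [← degree_eq_natDegree hq]), ?_⟩
    rw [LinearMap.mem_ker, map_sub, sub_eq_zero] at hrS
    exact hrS.symm
  have : FiniteDimensional F (degreeLT F q.natDegree) :=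
    (degreeLTEquiv F q.natDegree).symm.finiteDimensional
  exact Submodule.finiteDimensional_of_le hle

theorem exists_orbitMap_mem (V : Submodule F W) [FiniteDimensional F (W ⧸ V)] (x : W) :
    ∃ q : F[X], q ≠ 0 ∧ orbitMap φ x q ∈ V := by
  by_contra! hc
  have : Function.Injective (V.mkQ ∘ₗ orbitMap φ x) := by
    rw [← LinearMap.ker_eq_bot, LinearMap.ker_eq_bot']
    intro q hq
    by_contra hq0
    exact hc q hq0 (by simpa using hq)
  have := Module.Finite.of_injective _ this
  exact Polynomial.not_finite this

/-- Fitting's lemma for a Frobenius-semilinear map over a perfect field. -/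
theorem exists_iterate_eq_iterate [PerfectRing F p] {U : Submodule F W} [FiniteDimensional F U]
    (hU : ∀ x ∈ U, φ x ∈ U) :
    ∃ k, ∀ n, ∀ x ∈ U, ∃ y ∈ U, φ^[k] x = φ^[k + n] y := by
  -- Perfectness makes the image of a subspace under `φ` a subspace again.
  have hsurj : RingHomSurjective (frobenius F p) := ⟨(frobeniusEquiv F p).surjective⟩
  let R : ℕ → Submodule F W := fun k => (Submodule.map φ)^[k] U
  have hsucc : ∀ k, R (k + 1) = (R k).map φ := fun k => Function.iterate_succ_apply' _ _ _
  have hmem : ∀ k x, x ∈ R k ↔ ∃ y ∈ U, φ^[k] y = x := fun k => by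
    induction k with
    | zero => intro x; simp [R]
    | succ k ih =>
      intro x
      simp only [hsucc, Submodule.mem_map, ih, Function.iterate_succ_apply']
      constructor
      · rintro ⟨_, ⟨y, hy, rfl⟩, rfl⟩; exact ⟨y, hy, rfl⟩
      · rintro ⟨y, hy, rfl⟩; exact ⟨_, ⟨y, hy, rfl⟩, rfl⟩
  have hanti : Antitone R := antitone_nat_of_succ_le fun k => by
    intro x hx
    obtain ⟨y, hy, rfl⟩ := (hmem _ _).1 hx
    exact (hmem _ _).2 ⟨φ y, hU y hy, rfl⟩
  obtain ⟨k, hk⟩ := IsArtinian.monotone_stabilizes (R := F) (M := U)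
    ⟨fun k => OrderDual.toDual ((R k).comap U.subtype), fun i j hij =>
      Submodule.comap_mono (f := U.subtype) (hanti hij)⟩
  refine ⟨k, fun n x hx => ?_⟩
  have hUk : R k ≤ U := hanti (Nat.zero_le k)
  have h1 : φ^[k] x ∈ R k := (hmem _ _).2 ⟨x, hx, rfl⟩
  have h2 : (⟨φ^[k] x, hUk h1⟩ : U) ∈ (R (k + n)).comap U.subtype := by
    have := hk (k + n) (Nat.le_add_right _ _)
    have h3 : (R k).comap U.subtype = (R (k + n)).comap U.subtype := this
    rw [← h3]
    exact h1
  obtain ⟨y, hy, h⟩ := (hmem _ _).1 h2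
  exact ⟨y, hy, h.symm⟩

theorem iterate_sub (n : ℕ) (x y : W) : φ^[n] (x - y) = φ^[n] x - φ^[n] y := by
  induction n with
  | zero => rfl
  | succ n ih => simp only [Function.iterate_succ_apply', ih, map_sub]

end Orbit


/-! ### Additive polynomials and their roots -/

section Linearize

variable {F : Type*} [Field F] {p : ℕ} [ExpChar F p]

variable (p) in
/-- The additive polynomial `∑ aᵢ X ^ (p ^ i)` attached to `∑ aᵢ X ^ i`. -/
noncomputable def linearize : F[X] →ₗ[F] F[X] :=
  orbitMap (LinearMap.frobenius F F[X] p) X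

theorem iterate_frobenius {A : Type*} [CommRing A] [Algebra F A] [ExpChar A p] (a : A) (i : ℕ) :
    (LinearMap.frobenius F A p)^[i] a = a ^ p ^ i := by
  induction i with
  | zero => simp
  | succ i ih =>
    rw [Function.iterate_succ_apply', ih, LinearMap.frobenius_def, ← pow_mul, pow_succ]

theorem linearize_monomial (i : ℕ) (a : F) :
    linearize p (monomial i a) = monomial (p ^ i) a := by
  rw [linearize, orbitMap_monomial, iterate_frobenius, ← C_mul_X_pow_eq_monomial, smul_eq_C_mul]

theorem aeval_linearize_monomial {A : Type*} [CommRing A] [Algebra F A] (a : A) (i : ℕ) (c : F) :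
    aeval a (linearize p (monomial i c)) = c • a ^ p ^ i := by
  rw [linearize_monomial, aeval_monomial, Algebra.smul_def]

theorem aeval_linearize {A : Type*} [CommRing A] [Algebra F A] [ExpChar A p] (a : A) (q : F[X]) :
    aeval a (linearize p q) = orbitMap (LinearMap.frobenius F A p) a q := by
  induction q using Polynomial.induction_on' with
  | add q r hq hr => simp [hq, hr]
  | monomial i c => rw [aeval_linearize_monomial, orbitMap_monomial, iterate_frobenius]

theorem map_orbitMap {V : Type*} [AddCommGroup V] [Module F V] {φ : V →ₛₗ[frobenius F p] V}
    {A : Type*} [CommRing A] [Algebra F A] {j : V →ₗ[F] A} (hj : ∀ x, j (φ x) = j x ^ p)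
    (x : V) (q : F[X]) : j (orbitMap φ x q) = aeval (j x) (linearize p q) := by
  have h : ∀ i, j (φ^[i] x) = j x ^ p ^ i := fun i => by
    induction i with
    | zero => simp
    | succ i ih => rw [Function.iterate_succ_apply', hj, ih, ← pow_mul, pow_succ]
  induction q using Polynomial.induction_on' with
  | add q r hq hr => simp [hq, hr]
  | monomial i c => rw [aeval_linearize_monomial, orbitMap_monomial, map_smul, h]

/-- `F[t]` is finite-dimensional while `F[X]` is not, so linearizing and then evaluating at `t`
cannot be injective. -/
theorem exists_linearize_aeval_eq_zero {K : Type*} [Field K] [Algebra F K]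
    [Algebra.IsAlgebraic F K] (t : K) :
    ∃ q : F[X], q ≠ 0 ∧ aeval t (linearize p q) = 0 := by
  set E := Algebra.adjoin F {t}
  have hE : FiniteDimensional F E :=
    (Algebra.IsIntegral.isIntegral t).fg_adjoin_singleton |> Module.Finite.of_fg
  let g : F[X] →ₗ[F] E :=
    (aeval (⟨t, Algebra.self_mem_adjoin_singleton F t⟩ : E)).toLinearMap ∘ₗ linearize p
  by_contra! hc
  have hg : Function.Injective g := by
    rw [← LinearMap.ker_eq_bot, LinearMap.ker_eq_bot']
    intro q hq
    by_contra hq0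
    apply hc q hq0
    have := congrArg E.val hq
    simpa [g, ← aeval_algHom_apply] using this
  have := Module.Finite.of_injective _ hg
  exact Polynomial.not_finite this

variable [hp : Fact p.Prime]

theorem coeff_linearize_pow (q : F[X]) (n : ℕ) : (linearize p q).coeff (p ^ n) = q.coeff n := by
  induction q using Polynomial.induction_on' with
  | add q r hq hr => simp [hq, hr]
  | monomial i c =>
    simp only [linearize_monomial, coeff_monomial, Nat.pow_right_inj hp.out.one_lt]

theorem linearize_ne_zero {q : F[X]} (hq : q ≠ 0) : linearize p q ≠ 0 := by
  intro h
  apply leadingCoeff_ne_zero.2 hq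
  rw [leadingCoeff, ← coeff_linearize_pow (p := p), h, coeff_zero]

variable {K : Type*} [Field K] [Algebra F K] [IsAlgClosed K]

theorem exists_aeval_linearize_eq {q : F[X]} (hq : q ≠ 0) (k : K) :
    ∃ t : K, aeval t (linearize p q) = k := by
  -- Subtracting the constant `k` leaves the coefficient at `p ^ q.natDegree ≥ 1` intact, so the
  -- polynomial is nonconstant.
  have hn : ((linearize p q).map (algebraMap F K) - C k).coeff (p ^ q.natDegree) ≠ 0 := by
    rw [coeff_sub, coeff_map, coeff_linearize_pow, coeff_C_of_ne_zero (pow_ne_zero _ hp.out.ne_zero),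
      sub_zero, _root_.map_ne_zero]
    exact leadingCoeff_ne_zero.2 hq
  obtain ⟨t, ht⟩ := IsAlgClosed.exists_root ((linearize p q).map (algebraMap F K) - C k) (by
    intro h0
    rw [eq_C_of_degree_eq_zero h0, coeff_C_of_ne_zero (pow_ne_zero _ hp.out.ne_zero)] at hn
    exact hn rfl)
  refine ⟨t, ?_⟩
  rw [IsRoot.def, eval_sub, eval_C, sub_eq_zero, eval_map_algebraMap] at ht
  exact ht

/-- With `0` as its only root, a polynomial over `K` would be a single monomial, but this one has
nonzero coefficients at both `p ^ i` and `p ^ j`. -/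
theorem exists_ne_zero_aeval_linearize_eq_zero {q : F[X]} {i j : ℕ} (hij : i ≠ j)
    (hi : q.coeff i ≠ 0) (hj : q.coeff j ≠ 0) :
    ∃ t : K, t ≠ 0 ∧ aeval t (linearize p q) = 0 := by
  by_contra! hc
  set P := (linearize p q).map (algebraMap F K) with hP
  have hcoeff : ∀ n, P.coeff (p ^ n) = algebraMap F K (q.coeff n) := fun n => by
    rw [hP, coeff_map, coeff_linearize_pow]
  have hroots : P.roots = Multiset.replicate P.roots.card 0 := by
    refine Multiset.eq_replicate.2 ⟨rfl, fun t ht => ?_⟩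
    by_contra h0
    apply hc t h0
    have := isRoot_of_mem_roots ht
    rwa [IsRoot.def, hP, eval_map_algebraMap] at this
  have hprod := (IsAlgClosed.splits P).eq_prod_roots
  rw [hroots] at hprod
  simp only [Multiset.map_replicate, Multiset.prod_replicate, map_zero, sub_zero] at hprod
  have key : ∀ n, q.coeff n ≠ 0 → p ^ n = P.roots.card := fun n hn => by
    by_contra hne
    have h1 := hcoeff n
    rw [hprod, coeff_C_mul_X_pow, if_neg hne] at h1
    exact hn ((map_eq_zero _).1 h1.symm)
  exact hij (Nat.pow_right_injective hp.out.two_le ((key i hi).trans (key j hj).symm))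

end Linearize

/-! ### Extending equivariant maps into an algebraically closed field -/

section Extension

variable {F : Type*} [Field F] {p : ℕ} [ExpChar F p]
variable {V : Type*} [AddCommGroup V] [Module F V] (φ : V →ₛₗ[frobenius F p] V)
variable {K : Type*} [Field K] [Algebra F K] [ExpChar K p]

variable (K) in
/-- The product of a Frobenius-semilinear map with the Frobenius of an `F`-algebra. -/
noncomputable def prodFrobenius : V × K →ₛₗ[frobenius F p] V × K where
  toFun z := (φ z.1, LinearMap.frobenius F K p z.2)
  map_add' _ _ := by simp
  map_smul' _ _ := by simp

/-- The graph of a partially defined linear map `V → K` which intertwines `φ` with the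
Frobenius of `K`. -/
structure IsStableGraph (G : Submodule F (V × K)) : Prop where
  stable : ∀ z ∈ G, prodFrobenius φ K z ∈ G
  eq_zero : ∀ k : K, (0, k) ∈ G → k = 0

theorem orbitMap_prodFrobenius (x : V) (t : K) (q : F[X]) :
    orbitMap (prodFrobenius φ K) (x, t) q = (orbitMap φ x q, aeval t (linearize p q)) := by
  rw [aeval_linearize]
  exact Prod.ext
    (orbitMap_comp (prodFrobenius φ K) (φ' := φ) (LinearMap.fst F V K) (fun _ => rfl) (x, t) q)
    (orbitMap_comp (prodFrobenius φ K) (φ' := LinearMap.frobenius F K p) (LinearMap.snd F V K)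
      (fun _ => rfl) (x, t) q)

variable {φ}

/-- Sending `x` to `t` is consistent once the relations that bring `x` into the domain of `G` also
hold for the pair `(x, t)`. By division it suffices to have one such relation of no larger degree
for each. -/
theorem IsStableGraph.sup_range {G : Submodule F (V × K)} (hG : IsStableGraph φ G) (x : V) (t : K)
    (h : ∀ q k, q ≠ 0 → (orbitMap φ x q, k) ∈ G →
      ∃ q₀ : F[X], q₀ ≠ 0 ∧ q₀.degree ≤ q.degree ∧ orbitMap (prodFrobenius φ K) (x, t) q₀ ∈ G) :
    IsStableGraph φ (G ⊔ LinearMap.range (orbitMap (prodFrobenius φ K) (x, t))) := by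
  have key : ∀ q k, (orbitMap φ x q, k) ∈ G → orbitMap (prodFrobenius φ K) (x, t) q ∈ G := by
    intro q
    induction hn : q.degree using WellFoundedLT.induction generalizing q with
    | ind n ih =>
      subst hn
      intro k hk
      by_cases hq : q = 0
      · simp [hq]
      obtain ⟨q₀, hq₀, hle, hmem⟩ := h q k hq hk
      obtain ⟨r, hr, hrS⟩ := exists_degree_lt_sub_mem
        (G.comap (orbitMap (prodFrobenius φ K) (x, t))) hq₀ (fun j => by
          induction j with
          | zero => exact hmem
          | succ j ihj =>
            rw [Function.iterate_succ_apply', Submodule.mem_comap, orbitMap_twist]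
            exact hG.stable _ ihj) q
      rw [Submodule.mem_comap] at hrS
      -- The remainder again brings `x` into the domain of `G`, in smaller degree.
      have hr' := ih _ (hr.trans_le hle) r rfl
        (k - (orbitMap (prodFrobenius φ K) (x, t) (q - r)).2) (by
          convert G.sub_mem hk hrS using 1
          rw [orbitMap_prodFrobenius]
          simp)
      simpa using G.add_mem hrS hr'
  refine ⟨fun z hz => ?_, fun k hk => ?_⟩
  · obtain ⟨g, hg, s, hs, rfl⟩ := Submodule.mem_sup.1 hz
    rw [map_add]
    exact Submodule.add_mem_sup (hG.stable g hg) (map_mem_range_orbitMap _ hs)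
  · obtain ⟨g, hg, _, ⟨q, rfl⟩, h0⟩ := Submodule.mem_sup.1 hk
    have hq : orbitMap (prodFrobenius φ K) (x, t) q ∈ G := by
      refine key q (-g.2) ?_
      convert G.neg_mem hg using 1
      rw [orbitMap_prodFrobenius] at h0
      exact Prod.ext (eq_neg_of_add_eq_zero_right (congrArg Prod.fst h0)) rfl
    exact hG.eq_zero k (h0 ▸ G.add_mem hg hq)

theorem exists_minimal_degree {S : F[X] → Prop} (hS : ∃ q, q ≠ 0 ∧ S q) :
    ∃ q₀, q₀ ≠ 0 ∧ S q₀ ∧ ∀ q, q ≠ 0 → S q → q₀.degree ≤ q.degree := by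
  obtain ⟨q₀, h1, h2⟩ := WellFounded.has_min (InvImage.wf (degree (R := F)) wellFounded_lt)
    {q | q ≠ 0 ∧ S q} hS
  exact ⟨q₀, h1.1, h1.2, fun q hq hqS => not_lt.1 (h2 q ⟨hq, hqS⟩)⟩

theorem isStableGraph_prod_bot {U : Submodule F V} (hU : ∀ x ∈ U, φ x ∈ U) :
    IsStableGraph φ (U.prod (⊥ : Submodule F K)) where
  stable := by
    rintro ⟨x, k⟩ ⟨hx, hk⟩
    refine ⟨hU x hx, ?_⟩
    obtain rfl : k = 0 := hk
    exact map_zero (LinearMap.frobenius F K p)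
  eq_zero _ h := h.2

variable (φ K) in
/-- The linear maps `V → K` which intertwine `φ` with the Frobenius of `K`. -/
def equivariantMaps : Set (V →ₗ[F] K) := {f | ∀ x, f (φ x) = f x ^ p}

variable [Fact p.Prime] [IsAlgClosed K]

/-- A relation of minimal degree imposes a single additive polynomial equation on `t`, solvable in
`K`; with no relation every `t` works. -/
theorem IsStableGraph.exists_sup_range {G : Submodule F (V × K)} (hG : IsStableGraph φ G) (x : V) :
    ∃ t : K, IsStableGraph φ (G ⊔ LinearMap.range (orbitMap (prodFrobenius φ K) (x, t))) := by
  by_cases hI : ∃ q : F[X], q ≠ 0 ∧ ∃ k, (orbitMap φ x q, k) ∈ G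
  · obtain ⟨q₀, hq₀, ⟨k, hk⟩, hmin⟩ := exists_minimal_degree hI
    obtain ⟨t, ht⟩ := exists_aeval_linearize_eq (p := p) hq₀ k
    refine ⟨t, hG.sup_range x t fun q k' hq hk' => ⟨q₀, hq₀, hmin q hq ⟨k', hk'⟩, ?_⟩⟩
    rw [orbitMap_prodFrobenius, ht]
    exact hk
  · push Not at hI
    exact ⟨0, hG.sup_range x 0 fun q k hq hk => (hI q hq k hk).elim⟩

/-- A maximal stable graph, from Zorn's lemma, is total by the one-element extension. -/
theorem IsStableGraph.exists_linearMap {G : Submodule F (V × K)} (hG : IsStableGraph φ G) :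
    ∃ f : V →ₗ[F] K, (∀ x, f (φ x) = f x ^ p) ∧ ∀ z ∈ G, f z.1 = z.2 := by
  obtain ⟨M, hGM, hM⟩ := zorn_le_nonempty₀ {G | IsStableGraph (K := K) φ G} (by
    intro c hc hchain y hy
    have hdir := fun {z} => Submodule.mem_sSup_of_directed (z := z) ⟨y, hy⟩ hchain.directedOn
    refine ⟨sSup c, ⟨fun z hz => ?_, fun k hk => ?_⟩, fun z hz => le_sSup hz⟩
    · obtain ⟨H, hH, hzH⟩ := hdir.1 hz
      exact hdir.2 ⟨H, hH, (hc hH).stable z hzH⟩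
    · obtain ⟨H, hH, hkH⟩ := hdir.1 hk
      exact (hc hH).eq_zero k hkH) G hG
  have hMg : IsStableGraph φ M := hM.prop
  have htot : ∀ x, ∃ k, (x, k) ∈ M := fun x => by
    obtain ⟨t, ht⟩ := hMg.exists_sup_range x
    refine ⟨t, hM.le_of_ge ht le_sup_left (Submodule.mem_sup_right ⟨1, ?_⟩)⟩
    rw [orbitMap_one]
  have huniq : ∀ {x k k'}, (x, k) ∈ M → (x, k') ∈ M → k = k' := fun {x k k'} h h' => by
    refine sub_eq_zero.1 (hMg.eq_zero _ ?_)
    simpa using M.sub_mem h h'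
  choose f hf using htot
  exact ⟨{ toFun := f
           map_add' := fun x y => huniq (hf _) (M.add_mem (hf x) (hf y))
           map_smul' := fun a x => huniq (hf _) (M.smul_mem a (hf x)) },
    fun x => huniq (hf _) (hMg.stable _ (hf x)), fun z hz => huniq (hf _) (hGM hz)⟩

theorem exists_equivariantMap_apply_eq {x : V} (hx : ∀ q, orbitMap φ x q = 0 → q = 0) (t : K) :
    ∃ f ∈ equivariantMaps φ K, f x = t := by
  have h0 : IsStableGraph (K := K) φ ((⊥ : Submodule F V).prod ⊥) :=
    isStableGraph_prod_bot (by simp)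
  obtain ⟨f, hf, hfG⟩ := (h0.sup_range x t fun q k hq hk => (hq (hx q hk.1)).elim).exists_linearMap
  refine ⟨f, hf, hfG (x, t) (Submodule.mem_sup_right ⟨1, ?_⟩)⟩
  rw [orbitMap_one]

/-- A minimal relation bringing `x` into `U` is not a monomial, since no iterate of `x` lies in `U`.
Its additive polynomial thus has a nonzero root, usable as the value at `x`. -/
theorem exists_equivariantMap_apply_ne_zero {U : Submodule F V} (hU : ∀ x ∈ U, φ x ∈ U) {x : V}
    (hx : ∀ n, φ^[n] x ∉ U) :
    ∃ f ∈ equivariantMaps φ K, U ≤ LinearMap.ker f ∧ f x ≠ 0 := by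
  have h0 := isStableGraph_prod_bot (K := K) hU
  have : ∃ t : K, t ≠ 0 ∧ IsStableGraph φ
      (U.prod ⊥ ⊔ LinearMap.range (orbitMap (prodFrobenius φ K) (x, t))) := by
    by_cases hI : ∃ q : F[X], q ≠ 0 ∧ orbitMap φ x q ∈ U
    · obtain ⟨q₀, hq₀, hk, hmin⟩ := exists_minimal_degree hI
      obtain ⟨i, hi, hin⟩ : ∃ i, q₀.coeff i ≠ 0 ∧ i ≠ q₀.natDegree := by
        by_contra! hc
        have hmono : q₀ = monomial q₀.natDegree q₀.leadingCoeff := by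
          ext j
          rw [coeff_monomial]
          split_ifs with hj
          · rw [← hj]; rfl
          · by_contra h0
            exact hj (hc j h0).symm
        rw [hmono, orbitMap_monomial] at hk
        exact hx _ ((U.smul_mem_iff (leadingCoeff_ne_zero.2 hq₀)).1 hk)
      obtain ⟨t, ht0, ht⟩ := exists_ne_zero_aeval_linearize_eq_zero (p := p) (K := K) hin hi
        (leadingCoeff_ne_zero.2 hq₀)
      refine ⟨t, ht0, h0.sup_range x t fun q k' hq hk' => ⟨q₀, hq₀, hmin q hq hk'.1, ?_⟩⟩
      rw [orbitMap_prodFrobenius, ht]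
      exact ⟨hk, rfl⟩
    · push Not at hI
      exact ⟨1, one_ne_zero, h0.sup_range x 1 fun q k hq hk => (hI q hq hk.1).elim⟩
  obtain ⟨t, ht0, ht⟩ := this
  obtain ⟨f, hf, hfG⟩ := ht.exists_linearMap
  refine ⟨f, hf, fun y hy => hfG (y, 0) (Submodule.mem_sup_left ⟨hy, rfl⟩), ?_⟩
  rw [hfG (x, t) (Submodule.mem_sup_right ⟨1, orbitMap_one _ _⟩)]
  exact ht0

end Extension

/-! ### Finitely many kernels force finite codimension -/

section Finiteness

variable {F : Type*} [Field F] {p : ℕ} [ExpChar F p] [Fact p.Prime]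
variable {V : Type*} [AddCommGroup V] [Module F V] {φ : V →ₛₗ[frobenius F p] V}
variable {K : Type*} [Field K] [Algebra F K] [ExpChar K p] [IsAlgClosed K]

/-- Otherwise each `t` in `K` is `f t x` for some equivariant `f t`. Finitely many kernels then
cover the infinite field `K` by finite fibres. -/
theorem exists_orbitMap_eq_zero [Algebra.IsAlgebraic F K]
    (hfin : (LinearMap.ker '' equivariantMaps φ K).Finite) (x : V) :
    ∃ q, q ≠ 0 ∧ orbitMap φ x q = 0 := by
  by_contra! hc
  have hx : ∀ q, orbitMap φ x q = 0 → q = 0 := fun q hq => by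
    by_contra h0
    exact hc q h0 hq
  choose f hf hfx using exists_equivariantMap_apply_eq (K := K) hx
  -- If `q` annihilates `t`, then `orbitMap φ x q` lies in the common kernel, so each such `s` is a
  -- root of the same additive polynomial.
  have hfib : ∀ t : K, {s | LinearMap.ker (f s) = LinearMap.ker (f t)}.Finite := fun t => by
    obtain ⟨q, hq, hqt⟩ := exists_linearize_aeval_eq_zero (F := F) (p := p) t
    refine ((linearize p q).rootSet_finite K).subset fun s hs => ?_
    rw [mem_rootSet_of_ne (linearize_ne_zero hq)]
    rw [← hfx t, ← map_orbitMap (hf t), ← LinearMap.mem_ker, ← hs, LinearMap.mem_ker,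
      map_orbitMap (hf s), hfx s] at hqt
    exact hqt
  have hr : (Set.range fun t => LinearMap.ker (f t)).Finite :=
    hfin.subset (by rintro _ ⟨t, rfl⟩; exact ⟨f t, hf t, rfl⟩)
  have huniv : (Set.univ : Set K).Finite := by
    refine (Set.Finite.biUnion' hr (t := fun H _ => {s | LinearMap.ker (f s) = H}) ?_).subset
      fun s _ => Set.mem_biUnion ⟨s, rfl⟩ rfl
    rintro _ ⟨t, rfl⟩
    exact hfib t
  exact Set.infinite_univ huniv

/-- A finite-dimensional stable subspace absorbing every orbit. -/
theorem exists_finiteDimensional_iterate_mem [Algebra.IsAlgebraic F K]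
    (hfin : (LinearMap.ker '' equivariantMaps φ K).Finite) :
    ∃ U : Submodule F V, FiniteDimensional F U ∧ (∀ x ∈ U, φ x ∈ U) ∧
      ∀ x, ∃ n, φ^[n] x ∈ U := by
  have hpick : ∀ H : Submodule F V, ∃ x, H ≠ ⊤ → x ∉ H := fun H => by
    by_cases h : H = ⊤
    · exact ⟨0, fun h' => (h' h).elim⟩
    · obtain ⟨x, -, hx⟩ := SetLike.exists_of_lt (lt_top_iff_ne_top.2 h)
      exact ⟨x, fun _ => hx⟩
  choose c hc using hpick
  set T := LinearMap.ker '' equivariantMaps φ K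
  have : Finite T := hfin
  -- `U` lies in no proper kernel `H` of an equivariant map, because it contains `c H`.
  let U : Submodule F V := ⨆ H : T, LinearMap.range (orbitMap φ (c H))
  have hfd : ∀ H : T, FiniteDimensional F (LinearMap.range (orbitMap φ (c H))) := fun H => by
    obtain ⟨q, hq, h⟩ := exists_orbitMap_eq_zero hfin (c H)
    exact finiteDimensional_range_orbitMap φ hq h
  have hU : ∀ x ∈ U, φ x ∈ U := fun x hx => by
    induction hx using Submodule.iSup_induction' with
    | mem H x hx => exact Submodule.mem_iSup_of_mem H (map_mem_range_orbitMap φ hx)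
    | zero => simp
    | add x y _ _ hx hy => rw [map_add]; exact U.add_mem hx hy
  refine ⟨U, inferInstance, hU, fun x => ?_⟩
  by_contra! hx
  obtain ⟨f, hf, hfU, hfx⟩ := exists_equivariantMap_apply_ne_zero (K := K) hU hx
  have hmem : c (LinearMap.ker f) ∈ U :=
    Submodule.mem_iSup_of_mem (⟨_, f, hf, rfl⟩ : T) ⟨1, orbitMap_one _ _⟩
  refine hc (LinearMap.ker f) ?_ (hfU hmem)
  intro htop
  exact hfx (LinearMap.mem_ker.1 (htop ▸ Submodule.mem_top : x ∈ LinearMap.ker f))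

/-- If `φ^[n] x` lies in `U`, Fitting's lemma gives `y ∈ U` with `φ^[k + n] x = φ^[k + n] y`, so `x
- y` is killed by an iterate and `U` surjects onto `V ⧸ N`. -/
theorem finiteDimensional_quotient_of_finite_kernels [PerfectRing F p] [Algebra.IsAlgebraic F K]
    (hfin : (LinearMap.ker '' equivariantMaps φ K).Finite) (N : Submodule F V)
    (hN : ∀ x, (∃ n, φ^[n] x = 0) → x ∈ N) : FiniteDimensional F (V ⧸ N) := by
  obtain ⟨U, hUfd, hU, habs⟩ := exists_finiteDimensional_iterate_mem hfin
  obtain ⟨k, hk⟩ := exists_iterate_eq_iterate φ hU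
  refine Module.Finite.of_surjective (N.mkQ ∘ₗ U.subtype) fun z => ?_
  obtain ⟨x, rfl⟩ := N.mkQ_surjective z
  obtain ⟨n, hn⟩ := habs x
  obtain ⟨y, hy, hxy⟩ := hk n _ hn
  refine ⟨⟨y, hy⟩, ?_⟩
  rw [← Function.iterate_add_apply] at hxy
  have : x - y ∈ N := hN _ ⟨k + n, by rw [iterate_sub φ, hxy, sub_self]⟩
  exact ((Submodule.Quotient.eq N).2 this).symm

end Finiteness

end FrobeniusSemilinear
-- Semiperfect commutative algebras
section Semiperfect

theorem Ring.finite_setOf_isMaximal_of_isArtinianRing_quotient_jacobson {A : Type*} [CommRing A]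
    [IsArtinianRing (A ⧸ Ring.jacobson A)] : {m : Ideal A | m.IsMaximal}.Finite := by
  refine (Set.finite_range fun m : MaximalSpectrum (A ⧸ Ring.jacobson A) =>
    m.asIdeal.comap (Ideal.Quotient.mk (Ring.jacobson A))).subset fun m hm => ?_
  have hm' : m.IsMaximal := hm
  have hle : Ring.jacobson A ≤ m := by
    rw [Ring.jacobson_eq_sInf_isMaximal]
    exact sInf_le hm
  have hcomap : (m.map (Ideal.Quotient.mk (Ring.jacobson A))).comap
      (Ideal.Quotient.mk (Ring.jacobson A)) = m := by
    rw [Ideal.comap_map_mk hle]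
  refine ⟨⟨m.map (Ideal.Quotient.mk (Ring.jacobson A)), ?_⟩, hcomap⟩
  refine (Ideal.map_eq_top_or_isMaximal_of_surjective _ Ideal.Quotient.mk_surjective hm').resolve_left
    fun h => hm'.ne_top ?_
  rw [← hcomap, h, Ideal.comap_top]

theorem AlgHom.isMaximal_ker_of_isAlgebraic {F A K : Type*} [Field F] [CommRing A] [Algebra F A]
    [Field K] [Algebra F K] [Algebra.IsAlgebraic F K] (g : A →ₐ[F] K) :
    (RingHom.ker g).IsMaximal := by
  have hf : IsField g.range := Subalgebra.isField_of_algebraic g.range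
  let := hf.toField
  have h := RingHom.ker_isMaximal_of_surjective g.rangeRestrict.toRingHom g.rangeRestrict_surjective
  have hker : RingHom.ker g = RingHom.ker g.rangeRestrict.toRingHom := by
    ext a
    exact (Subtype.ext_iff (a1 := g.rangeRestrict a) (a2 := 0)).symm
  exact hker ▸ h

/-- The Artinian reduced ring `A ⧸ nilradical A` has zero Jacobson radical, so the Jacobson radical
of `A` is its nilradical, and idempotents lift modulo a nil ideal. -/
theorem isSemiperfectRing_of_isArtinianRing_quotient_nilradical {A : Type*} [CommRing A]
    [IsArtinianRing (A ⧸ nilradical A)] : IsSemiperfectRing A := by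
  have hJ : Ring.jacobson A = nilradical A := by
    refine le_antisymm ?_ (nilradical_le_jacobson A)
    rw [← Ideal.jacobson_bot]
    refine (Ideal.jacobson_mono bot_le).trans (le_of_eq ?_ : (nilradical A).jacobson ≤ _)
    have h := Ideal.comap_jacobson_of_surjective
      (f := Ideal.Quotient.mk (nilradical A)) Ideal.Quotient.mk_surjective (K := ⊥)
    rw [IsArtinianRing.jacobson_eq_radical] at h
    change Ideal.comap _ (nilradical (A ⧸ nilradical A)) = _ at h
    have : IsReduced (A ⧸ nilradical A) :=
      (Ideal.isRadical_iff_quotient_reduced _).1 (Ideal.radical_isRadical _)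
    rw [nilradical_eq_zero (A ⧸ nilradical A), Ideal.zero_eq_bot, ← RingHom.ker_eq_comap_bot, Ideal.mk_ker] at h
    exact h.symm
  constructor
  · exact (Ideal.Quotient.factor_surjective hJ.ge).isArtinianRing
  · intro e he
    refine exists_isIdempotentElem_eq_of_ker_isNilpotent (Ideal.Quotient.mk (Ring.jacobson A))
      (fun x hx => ?_) e (Ideal.Quotient.mk_surjective e) he
    rwa [Ideal.mk_ker, hJ, mem_nilradical] at hx

open Polynomial FrobeniusSemilinear in
/-- The semiperfectness criterion, for a commutative algebra generated by a Frobenius-semilinear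
space `V`, all of whose equivariant maps to an algebraic closure of `F` extend to the algebra. -/
theorem isSemiperfectRing_iff_finiteDimensional_quotient {F : Type*} [Field F] {p : ℕ}
    [Fact p.Prime] [ExpChar F p] [PerfectRing F p] {V : Type*} [AddCommGroup V] [Module F V]
    {φ : V →ₛₗ[frobenius F p] V} (K : Type*) [Field K] [Algebra F K] [ExpChar K p] [IsAlgClosed K]
    [Algebra.IsAlgebraic F K] {A : Type*} [CommRing A] [Algebra F A] (j : V →ₗ[F] A)
    (hj : ∀ x, j (φ x) = j x ^ p) (hgen : Algebra.adjoin F (Set.range j) = ⊤)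
    (hext : ∀ f ∈ equivariantMaps φ K, ∃ g : A →ₐ[F] K, ∀ x, g (j x) = f x)
    (N : Submodule F V) (hN : ∀ x, x ∈ N ↔ ∃ n, φ^[n] x = 0) :
    IsSemiperfectRing A ↔ FiniteDimensional F (V ⧸ N) := by
  constructor
  · intro h
    have := h.isArtinianRing_quotient
    refine finiteDimensional_quotient_of_finite_kernels (φ := φ) (K := K) ?_ N fun x => (hN x).2
    refine (Ring.finite_setOf_isMaximal_of_isArtinianRing_quotient_jacobson.image
      fun m : Ideal A => (m.restrictScalars F).comap j).subset ?_
    rintro _ ⟨f, hf, rfl⟩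
    obtain ⟨g, hg⟩ := hext f hf
    refine ⟨RingHom.ker g, g.isMaximal_ker_of_isAlgebraic, ?_⟩
    ext x
    simp [hg]
  · intro h
    let π : A →ₐ[F] A ⧸ nilradical A := Ideal.Quotient.mkₐ F (nilradical A)
    have hπ : Function.Surjective π := Ideal.Quotient.mk_surjective
    let j' : V →ₗ[F] A ⧸ nilradical A := π.toLinearMap ∘ₗ j
    have hj' : ∀ x, j' (φ x) = j' x ^ p := fun x => by simp [j', hj]
    have hpow : ∀ n x, j (φ^[n] x) = j x ^ p ^ n := fun n x => by
      induction n with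
      | zero => simp
      | succ n ih => rw [Function.iterate_succ_apply', hj, ih, ← pow_mul, pow_succ]
    have hN' : N ≤ LinearMap.ker j' := fun x hx => by
      obtain ⟨n, hn⟩ := (hN x).1 hx
      refine Ideal.Quotient.eq_zero_iff_mem.2 (mem_nilradical.2 ⟨p ^ n, ?_⟩)
      rw [← hpow, hn, map_zero]
    have hfg : (LinearMap.range j').FG := by
      rw [← Submodule.range_liftQ N j' hN']
      have : Module.Finite F (LinearMap.range (N.liftQ j' hN')) := inferInstance
      exact Module.Finite.iff_fg.1 this
    obtain ⟨s, hs⟩ := hfg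
    have hadj : Algebra.adjoin F (s : Set (A ⧸ nilradical A)) = ⊤ := by
      rw [← Algebra.adjoin_span, hs, LinearMap.coe_range]
      have : Set.range j' = π '' Set.range j := by
        rw [← Set.range_comp]
        rfl
      rw [this, ← AlgHom.map_adjoin, hgen, Algebra.map_top]
      exact (AlgHom.range_eq_top π).2 hπ
    have hint : ∀ y ∈ (s : Set (A ⧸ nilradical A)), IsIntegral F y := fun y hy => by
      have hy' : y ∈ LinearMap.range j' := hs ▸ Submodule.subset_span hy
      obtain ⟨x, rfl⟩ := hy'
      -- Finite codimension of `N` gives a relation for `x` modulo `N`; its linearization is an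
      -- algebraic equation for `j' x`.
      obtain ⟨q, hq, hqN⟩ := exists_orbitMap_mem φ N x
      refine IsAlgebraic.isIntegral ⟨linearize p q, linearize_ne_zero hq, ?_⟩
      rw [← map_orbitMap hj']
      exact hN' hqN
    have hfin : Module.Finite F (A ⧸ nilradical A) := by
      have := fg_adjoin_of_finite s.finite_toSet hint
      rw [hadj] at this
      exact ⟨this⟩
    have := IsArtinianRing.of_finite F (A ⧸ nilradical A)
    exact isSemiperfectRing_of_isArtinianRing_quotient_nilradical

end Semiperfect

/-! ### Enveloping algebras and the power mapping -/

section UniversalEnvelopingAlgebra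

attribute [local instance] LieRing.ofAssociativeRing

/-- By the universal property, the lift of `ι` into the subalgebra, followed by inclusion, is the
identity. -/
theorem UniversalEnvelopingAlgebra.adjoin_range_ι (F L : Type*) [CommRing F] [LieRing L]
    [LieAlgebra F L] :
    Algebra.adjoin F (Set.range (UniversalEnvelopingAlgebra.ι F (L := L))) = ⊤ := by
  set S := Algebra.adjoin F (Set.range (UniversalEnvelopingAlgebra.ι F (L := L))) with hS
  let i : L →ₗ⁅F⁆ S :=
    { toFun := fun x => ⟨UniversalEnvelopingAlgebra.ι F x, Algebra.subset_adjoin ⟨x, rfl⟩⟩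
      map_add' := fun x y => Subtype.ext (by simp)
      map_smul' := fun a x => Subtype.ext (by simp)
      map_lie' := fun {x y} => Subtype.ext (by simp [LieRing.of_associative_ring_bracket]) }
  have h : S.val.comp (UniversalEnvelopingAlgebra.lift F i) = AlgHom.id F _ := by
    apply UniversalEnvelopingAlgebra.hom_ext
    ext x
    simp [i]
  rw [eq_top_iff]
  rintro x -
  have hx := DFunLike.congr_fun h x
  exact (show _ = x from hx) ▸ (UniversalEnvelopingAlgebra.lift F i x).2

end UniversalEnvelopingAlgebra

namespace RestrictedLie

attribute [local instance] LieRing.ofAssociativeRing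

theorem jacobsonS_eq_zero {F : Type*} [Field F] {p : ℕ} {L : Type*} [LieRing L]
    [LieAlgebra F L] [IsLieAbelian L] (hp : 2 ≤ p) (i : ℕ) (x y : L) : jacobsonS F p i x y = 0 := by
  -- `p - 1 ≥ 1` guarantees at least one bracket; the zeroth coefficient would be `x` itself.
  obtain ⟨k, hk⟩ : ∃ k, p - 1 = k + 1 := ⟨p - 2, by omega⟩
  rw [jacobsonS, hk]
  cases i - 1 <;> simp [adCoeff, trivial_lie_zero]

variable (F : Type*) [Field F] (p : ℕ) (L : Type*) [LieRing L] [LieAlgebra F L]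
  [RestrictedLieAlgebra F p L]

/-- The canonical map from a restricted Lie algebra to its restricted enveloping algebra. -/
noncomputable def toEnveloping : L →ₗ[F] RestrictedEnvelopingAlgebra F p L :=
  (RingQuot.mkAlgHom F (Rel F p L)).toLinearMap ∘ₗ
    (UniversalEnvelopingAlgebra.ι F : L →ₗ⁅F⁆ UniversalEnvelopingAlgebra F L).toLinearMap

theorem toEnveloping_apply (x : L) : toEnveloping F p L x =
    RingQuot.mkAlgHom F (Rel F p L) (UniversalEnvelopingAlgebra.ι F x) := rfl

theorem toEnveloping_pMap (x : L) :
    toEnveloping F p L (RestrictedLieAlgebra.pMap F p x) = toEnveloping F p L x ^ p := by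
  rw [toEnveloping_apply, toEnveloping_apply, ← map_pow]
  exact (RingQuot.mkAlgHom_rel F (Rel.pow x)).symm

theorem adjoin_range_toEnveloping :
    Algebra.adjoin F (Set.range (toEnveloping F p L)) = ⊤ := by
  have : Set.range (toEnveloping F p L) = RingQuot.mkAlgHom F (Rel F p L) ''
      Set.range (UniversalEnvelopingAlgebra.ι F (L := L)) := by
    rw [← Set.range_comp]
    rfl
  rw [this, ← AlgHom.map_adjoin, UniversalEnvelopingAlgebra.adjoin_range_ι, Algebra.map_top]
  exact (AlgHom.range_eq_top _).2 (RingQuot.mkAlgHom_surjective F _)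

section Abelian

variable [IsLieAbelian L]

theorem restrictedEnvelopingAlgebra_mul_comm (a b : RestrictedEnvelopingAlgebra F p L) :
    a * b = b * a := by
  have hcomm : ∀ x ∈ Set.range (toEnveloping F p L), ∀ y ∈ Set.range (toEnveloping F p L),
      x * y = y * x := by
    rintro _ ⟨x, rfl⟩ _ ⟨y, rfl⟩
    have h : UniversalEnvelopingAlgebra.ι F x * UniversalEnvelopingAlgebra.ι F y =
        UniversalEnvelopingAlgebra.ι F y * UniversalEnvelopingAlgebra.ι F x := by
      rw [← sub_eq_zero, ← LieRing.of_associative_ring_bracket, ← LieHom.map_lie,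
        trivial_lie_zero, map_zero]
    simpa only [map_mul, toEnveloping_apply] using congrArg (RingQuot.mkAlgHom F (Rel F p L)) h

  have ha : a ∈ Algebra.adjoin F (Set.range (toEnveloping F p L)) := by
    rw [adjoin_range_toEnveloping]; trivial
  have hb : b ∈ Algebra.adjoin F (Set.range (toEnveloping F p L)) := by
    rw [adjoin_range_toEnveloping]; trivial
  have := Algebra.isMulCommutative_adjoin F hcomm
  exact congrArg Subtype.val
    (mul_comm' (⟨a, ha⟩ : Algebra.adjoin F (Set.range (toEnveloping F p L))) ⟨b, hb⟩)

/-- The restricted enveloping algebra of an abelian restricted Lie algebra is commutative. -/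
noncomputable abbrev restrictedEnvelopingCommRing :
    CommRing (RestrictedEnvelopingAlgebra F p L) :=
  { (inferInstance : Ring (RestrictedEnvelopingAlgebra F p L)) with
    mul_comm := restrictedEnvelopingAlgebra_mul_comm F p L }

variable {F p L}

theorem exists_algHom_restrictedEnveloping {K : Type*} [CommRing K] [Algebra F K]
    (f : L →ₗ[F] K) (hf : ∀ x, f (RestrictedLieAlgebra.pMap F p x) = f x ^ p) :
    ∃ g : RestrictedEnvelopingAlgebra F p L →ₐ[F] K, ∀ x, g (toEnveloping F p L x) = f x := by
  let f' : L →ₗ⁅F⁆ K :=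
    { f with
      map_lie' := fun {x y} => by
        simp [LieRing.of_associative_ring_bracket, mul_comm, trivial_lie_zero] }
  have h : ∀ ⦃a b⦄, Rel F p L a b →
      UniversalEnvelopingAlgebra.lift F f' a = UniversalEnvelopingAlgebra.lift F f' b := by
    rintro _ _ ⟨x⟩
    rw [map_pow, UniversalEnvelopingAlgebra.lift_ι_apply, UniversalEnvelopingAlgebra.lift_ι_apply]
    exact (hf x).symm
  refine ⟨RingQuot.liftAlgHom F ⟨_, h⟩, fun x => ?_⟩
  rw [toEnveloping_apply, RingQuot.liftAlgHom_mkAlgHom_apply,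
    UniversalEnvelopingAlgebra.lift_ι_apply]
  rfl

variable (F p L) in
/-- The power mapping of an abelian restricted Lie algebra, as a Frobenius-semilinear map. -/
noncomputable def pMapSemilinear [Fact p.Prime] [ExpChar F p] : L →ₛₗ[frobenius F p] L where
  toFun := RestrictedLieAlgebra.pMap F p
  map_add' x y := by
    rw [RestrictedLieAlgebra.pMap_add (F := F),
      Finset.sum_eq_zero fun i _ => jacobsonS_eq_zero (Fact.out : p.Prime).two_le i x y, add_zero]
  map_smul' a x := RestrictedLieAlgebra.pMap_smul a x

/-- Additivity of the power mapping makes the p-nilpotent elements themselves a p-nil restricted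
ideal, hence the largest one. -/
theorem mem_pCore_iff [Fact p.Prime] [ExpChar F p] (x : L) :
    x ∈ pCore F p L ↔ IsPNilpotent F p x := by
  let φ := pMapSemilinear F p L
  have hz : ∀ n, φ^[n] 0 = 0 := fun n => Function.iterate_fixed (map_zero φ) n
  have hle : ∀ {n m : ℕ} {x : L}, n ≤ m → φ^[n] x = 0 → φ^[m] x = 0 := fun {n m x} h hx => by
    rw [← Nat.sub_add_cancel h, Function.iterate_add_apply, hx, hz]
  have hadd : ∀ n x y, φ^[n] (x + y) = φ^[n] x + φ^[n] y := fun n => by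
    induction n with
    | zero => intros; rfl
    | succ n ih => intro x y; simp only [Function.iterate_succ_apply', ih, map_add]
  let N : LieIdeal F L :=
    { carrier := {x | ∃ n, φ^[n] x = 0}
      zero_mem' := ⟨0, rfl⟩
      add_mem' := by
        rintro x y ⟨n, hn⟩ ⟨m, hm⟩
        exact ⟨max n m, by
          rw [hadd, hle (le_max_left n m) hn, hle (le_max_right n m) hm, add_zero]⟩
      smul_mem' := by
        rintro a x ⟨n, hn⟩
        refine ⟨n, ?_⟩
        have : ∀ b : F, ∃ c : F, φ^[n] (b • x) = c • φ^[n] x := by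
          clear hn
          induction n with
          | zero => exact fun b => ⟨b, rfl⟩
          | succ n ih =>
            intro b
            obtain ⟨c, hc⟩ := ih b
            exact ⟨_, by rw [Function.iterate_succ_apply', hc, map_smulₛₗ,
              Function.iterate_succ_apply']⟩
        obtain ⟨c, hc⟩ := this a
        rw [hc, hn, smul_zero]
      lie_mem := by
        rintro x y -
        exact ⟨0, trivial_lie_zero L L x y⟩ }
  constructor
  · intro hx
    have : pCore F p L ≤ N := sSup_le fun I hI y hy => hI.2 y hy
    exact this hx
  · intro hx
    have : N ≤ pCore F p L := by
      refine le_sSup ⟨?_, fun y hy => hy⟩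
      rintro y ⟨n, hn⟩
      exact ⟨n, by
        change φ^[n] (φ y) = 0
        rw [← Function.iterate_succ_apply, Function.iterate_succ_apply', hn, map_zero]⟩
    exact this hx

end Abelian

end RestrictedLie

theorem corollary2p8 {F : Type*} [Field F] [PerfectField F] (p : ℕ) [Fact p.Prime] [CharP F p]
    {L : Type*} [LieRing L] [LieAlgebra F L] [RestrictedLieAlgebra F p L] [IsLieAbelian L] :
    IsSemiperfectRing (RestrictedEnvelopingAlgebra F p L) ↔
      FiniteDimensional F (L ⧸ (RestrictedLie.pCore F p L).toSubmodule) := by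
  have : ExpChar F p := ExpChar.prime Fact.out
  have : ExpChar (AlgebraicClosure F) p :=
    expChar_of_injective_algebraMap (algebraMap F (AlgebraicClosure F)).injective p
  -- This extends the existing ring structure, so semiperfectness refers to the same ring.
  let := RestrictedLie.restrictedEnvelopingCommRing F p L
  exact isSemiperfectRing_iff_finiteDimensional_quotient
    (φ := RestrictedLie.pMapSemilinear F p L) (AlgebraicClosure F)
    (RestrictedLie.toEnveloping F p L) (RestrictedLie.toEnveloping_pMap F p L)
    (RestrictedLie.adjoin_range_toEnveloping F p L)
    (fun f hf => RestrictedLie.exists_algHom_restrictedEnveloping f hf)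
    (RestrictedLie.pCore F p L).toSubmodule (fun x => RestrictedLie.mem_pCore_iff x)
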